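/- Let $n\ge 1$, let $C\in\mathbb R^{n\times n}$, and let $f:\mathbb R\times\mathbb R^n\to\mathbb R^n$ be continuous with $f(t,0)=0$ for all $t\in\mathbb R$; $\|\cdot\|$ is the Euclidean norm. Let $\alpha$ and $\beta$ be the minimum and the maximum of the real parts of the complex eigenvalues of $C$, and let $m_\alpha$, $m_\beta$ be the maximal degree of the elementary divisors (over $\mathbb C$) of $C$ belonging to eigenvalues with real part $\alpha$, respectively $\beta$. Assume that there is a function $\eta:[0,\infty)\to[0,\infty)$ such that ($C_3$) $\|f(t,x_1)-f(t,x_2)\|\le \eta(t)\|x_1-x_2\|$ for all $t\ge 0$ and $x_1,x_2\in\mathbb R^n$; ($C_4$) $\displaystyle\int_0^\infty t^{m_\beta+m_\alpha-2}\,e^{(\beta-\alpha)t}\,\eta(t)\,dt<\infty$. Let $t_0\ge 0$. Then: (i) every solution $u:[t_0,\infty)\to\mathbb R^n$ of $$u'=e^{-Ct}f(t,e^{Ct}u)\qquad(*)$$ is bounded on $[t_0,\infty)$ and converges to some vector in $\mathbb R^n$ as $t\to\infty$; (ii) for every solution $y:[t_0,\infty)\to\mathbb R^n$ of $y'=Cy+f(t,y)$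 there are a constant vector $c\in\mathbb R^n$ and a solution $u$ of $(*)$ on $[t_0,\infty)$ with $y(t)=e^{Ct}u(t)$ for $t\ge t_0$ and $u(t)\to c$ as $t\to\infty$, such that for all $t\ge t_0$ $$y(t)=e^{Ct}\,[\,c+r(t)\,],\qquad r(t)=-\int_t^\infty e^{-Cs}f(s,e^{Cs}u(s))\,ds,$$ where the integral converges absolutely, and $r(t)=o(1)$, i.e. $r(t)\to0$ as $t\to\infty$. -/

import Mathlib

open Filter Topology MeasureTheory Set

noncomputable section

namespace QuasilinearODE

/-- A real square matrix regarded as an endomorphism of `ℂⁿ`. -/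
def complexEnd {n : ℕ} (C : Matrix (Fin n) (Fin n) ℝ) : Module.End ℂ (Fin n → ℂ) :=
  Matrix.toLin' (C.map (algebraMap ℝ ℂ))

/-- The set of real parts of the (complex) eigenvalues of `C`. -/
def eigenRealParts {n : ℕ} (C : Matrix (Fin n) (Fin n) ℝ) : Set ℝ :=
  {ρ | ∃ z : ℂ, (complexEnd C).HasEigenvalue z ∧ z.re = ρ}

/-- `α = min_j Re λ_j`; the set is finite, and nonempty for `n ≥ 1`. -/
def minRe {n : ℕ} (C : Matrix (Fin n) (Fin n) ℝ) : ℝ := sInf (eigenRealParts C)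

/-- `β = max_j Re λ_j`. -/
def maxRe {n : ℕ} (C : Matrix (Fin n) (Fin n) ℝ) : ℝ := sSup (eigenRealParts C)

/-- `(X - z) ^ k` with `k ≥ 1` is an elementary divisor of `C` over `ℂ`: it occurs in a primary
cyclic decomposition of the `ℂ[X]`-module `ℂⁿ` on which `X` acts as `C`. (Summands with exponent
`0` are trivial modules and do not count as elementary divisors.) -/
def IsElementaryDivisor {n : ℕ} (C : Matrix (Fin n) (Fin n) ℝ) (z : ℂ) (k : ℕ) : Prop :=
  0 < k ∧ ∃ (ι : Type) (_ : Fintype ι) (w : ι → ℂ) (e : ι → ℕ),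
    Nonempty (Module.AEval' (complexEnd C) ≃ₗ[Polynomial ℂ]
      DirectSum ι fun i => Polynomial ℂ ⧸
        Ideal.span {(Polynomial.X - Polynomial.C (w i)) ^ e i}) ∧
    ∃ i, w i = z ∧ e i = k

/-- The maximal degree of the elementary divisors of `C` belonging to eigenvalues with real
part `ρ`; the degrees are bounded by `n`. -/
def maxElemDivDegree {n : ℕ} (C : Matrix (Fin n) (Fin n) ℝ) (ρ : ℝ) : ℕ :=
  sSup {k | ∃ z : ℂ, z.re = ρ ∧ IsElementaryDivisor C z k}

/-- The matrix `C` acting on Euclidean `ℝⁿ`. -/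
def act {n : ℕ} (C : Matrix (Fin n) (Fin n) ℝ) :
    EuclideanSpace ℝ (Fin n) →L[ℝ] EuclideanSpace ℝ (Fin n) :=
  Matrix.toEuclideanCLM (n := Fin n) (𝕜 := ℝ) C

/-- `e^{Ct}` acting on Euclidean `ℝⁿ`. -/
def expAct {n : ℕ} (C : Matrix (Fin n) (Fin n) ℝ) (t : ℝ) :
    EuclideanSpace ℝ (Fin n) →L[ℝ] EuclideanSpace ℝ (Fin n) :=
  NormedSpace.exp (t • act C)

/-- `y` solves `y' = F(t, y)` on `[t₀, ∞)` (one-sided derivative at `t₀`). -/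
def IsSolutionOn {n : ℕ} (F : ℝ → EuclideanSpace ℝ (Fin n) → EuclideanSpace ℝ (Fin n))
    (t₀ : ℝ) (y : ℝ → EuclideanSpace ℝ (Fin n)) : Prop :=
  ∀ t ∈ Ici t₀, HasDerivWithinAt y (F t (y t)) (Ici t₀) t

/-- The right-hand side `C y + f(t, y)`. -/
def quasilinearField {n : ℕ} (C : Matrix (Fin n) (Fin n) ℝ)
    (f : ℝ → EuclideanSpace ℝ (Fin n) → EuclideanSpace ℝ (Fin n))
    (t : ℝ) (y : EuclideanSpace ℝ (Fin n)) : EuclideanSpace ℝ (Fin n) :=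
  act C y + f t y

/-- The right-hand side `e^{-Ct} f(t, e^{Ct} u)`. -/
def transformedField {n : ℕ} (C : Matrix (Fin n) (Fin n) ℝ)
    (f : ℝ → EuclideanSpace ℝ (Fin n) → EuclideanSpace ℝ (Fin n))
    (t : ℝ) (u : EuclideanSpace ℝ (Fin n)) : EuclideanSpace ℝ (Fin n) :=
  expAct C (-t) (f t (expAct C t u))

/-- The Lipschitz condition `‖f(t,x₁) - f(t,x₂)‖ ≤ η(t) ‖x₁ - x₂‖` for `t ≥ 0`, with `η ≥ 0`. -/
def LipschitzCond {n : ℕ}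
    (f : ℝ → EuclideanSpace ℝ (Fin n) → EuclideanSpace ℝ (Fin n)) (η : ℝ → ℝ) : Prop :=
  (∀ t, 0 ≤ t → 0 ≤ η t) ∧
    ∀ t, 0 ≤ t → ∀ x₁ x₂, ‖f t x₁ - f t x₂‖ ≤ η t * ‖x₁ - x₂‖

/-- `∫₀^∞ t^{m_β + m_α - 2} e^{(β - α)t} η(t) dt < ∞`. -/
def WeightedIntegrableCond {n : ℕ} (C : Matrix (Fin n) (Fin n) ℝ) (η : ℝ → ℝ) : Prop :=
  IntegrableOn
    (fun t : ℝ => t ^ (maxElemDivDegree C (maxRe C) + maxElemDivDegree C (minRe C) - 2) *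
      Real.exp ((maxRe C - minRe C) * t) * η t) (Ioi 0)

end QuasilinearODE

end

/-! The substitution y = e^{Ct}u removes the linear part, and since f(t,0) = 0 the Lipschitz
condition gives ‖u'‖ ≤ ‖e^{-Ct}‖ ‖e^{Ct}‖ η(t) ‖u‖. The primary decomposition of ℂⁿ gives ‖e^{Ct}‖ =
O(t^{m_β-1} e^{βt}) and ‖e^{-Ct}‖ = O(t^{m_α-1} e^{-αt}), so the coefficient of ‖u‖ is bounded by a
multiple of the integrand in (C₄) (`exists_norm_expAct_neg_mul_norm_expAct_le`).

An integrable coefficient forces u to be bounded (`exists_norm_le_of_norm_deriv_le_mul_norm`). Hence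
u' is integrable, u has a limit c, and r = u - c is minus the integral of u' over the tail
(`exists_tendsto_of_integrableOn_deriv`). -/

noncomputable section

namespace QuasilinearODE

/-! ### Primary cyclic decomposition of a complex endomorphism -/

section PrimaryDecomposition

variable {V : Type*} [AddCommGroup V] [Module ℂ V]

/-- Structure theorem for torsion modules over the PID ℂ[X], where every irreducible is associated
to some X - z. -/
theorem exists_primary_cyclic_decomposition [FiniteDimensional ℂ V] (A : Module.End ℂ V) :
    ∃ (ι : Type) (_ : Fintype ι) (w : ι → ℂ) (e : ι → ℕ),
      Nonempty (Module.AEval' A ≃ₗ[Polynomial ℂ] DirectSum ι fun i => Polynomial ℂ ⧸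
        Ideal.span {(Polynomial.X - Polynomial.C (w i)) ^ e i}) := by
  obtain ⟨ι, hι, p, hp, e, ⟨φ⟩⟩ := Module.equiv_directSum_of_isTorsion
    (Module.AEval.isTorsion_of_finiteDimensional ℂ V A)
  have key : ∀ i, ∃ z : ℂ, Associated (p i) (Polynomial.X - Polynomial.C z) := fun i => by
    obtain ⟨z, hz⟩ := IsAlgClosed.exists_root (p i)
      (Polynomial.degree_pos_of_irreducible (hp i)).ne'
    exact ⟨z, ((Polynomial.irreducible_X_sub_C z).associated_of_dvd (hp i)
      (Polynomial.dvd_iff_isRoot.2 hz)).symm⟩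
  choose w hw using key
  have hI : (fun i => Ideal.span {p i ^ e i}) =
      fun i => Ideal.span {(Polynomial.X - Polynomial.C (w i)) ^ e i} := by
    funext i
    exact Ideal.span_singleton_eq_span_singleton.2 ((hw i).pow_pow)
  refine ⟨ι, hι, w, e, ?_⟩
  -- The ideals occur inside dependent types, so they are generalized to variables before the
  -- equality is substituted.
  have transport : ∀ I J : ι → Ideal (Polynomial ℂ), I = J →
      Nonempty (Module.AEval' A ≃ₗ[Polynomial ℂ] DirectSum ι fun i => Polynomial ℂ ⧸ I i) →
      Nonempty (Module.AEval' A ≃ₗ[Polynomial ℂ] DirectSum ι fun i => Polynomial ℂ ⧸ J i) := by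
    rintro I _ rfl h
    exact h
  exact transport _ _ hI ⟨φ⟩

theorem sub_algebraMap_pow_apply (A : Module.End ℂ V) (z : ℂ) (k : ℕ) (x : Module.AEval' A) :
    ((A - algebraMap ℂ (Module.End ℂ V) z) ^ k) ((Module.AEval'.of A).symm x) =
      (Module.AEval'.of A).symm ((Polynomial.X - Polynomial.C z) ^ k • x) := by
  have h := Module.AEval.of_symm_smul (R := ℂ) (M := V) A
    ((Polynomial.X - Polynomial.C z) ^ k) x
  rw [map_pow, map_sub, Polynomial.aeval_X, Polynomial.aeval_C] at h
  exact h.symm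

variable {A : Module.End ℂ V} {ι : Type} {w : ι → ℂ} {e : ι → ℕ}
  (φ : Module.AEval' A ≃ₗ[Polynomial ℂ] DirectSum ι fun i => Polynomial ℂ ⧸
    Ideal.span {(Polynomial.X - Polynomial.C (w i)) ^ e i})

include φ

/-- The vectors of each primary cyclic summand are generalized eigenvectors, and together
they span. -/
theorem primary_induction {P : V → Prop} (h0 : P 0) (hadd : ∀ v v', P v → P v' → P (v + v'))
    (hi : ∀ i, 0 < e i → ∀ v, ((A - algebraMap ℂ (Module.End ℂ V) (w i)) ^ e i) v = 0 → P v)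
    (v : V) : P v := by
  classical
  have key : ∀ x, P ((Module.AEval'.of A).symm (φ.symm x)) := by
    intro x
    induction x using DirectSum.induction_on with
    | zero => simpa using h0
    | add x y hx hy => simpa using hadd _ _ hx hy
    | of i q =>
      have hq : (Polynomial.X - Polynomial.C (w i)) ^ e i • q = 0 := by
        obtain ⟨q, rfl⟩ := Ideal.Quotient.mk_surjective q
        rw [← Ideal.Quotient.mk_eq_mk, ← Submodule.Quotient.mk_smul,
          Submodule.Quotient.mk_eq_zero, smul_eq_mul]
        exact Ideal.mul_mem_right _ _ (Ideal.mem_span_singleton_self _)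
      have hker : ((A - algebraMap ℂ (Module.End ℂ V) (w i)) ^ e i)
          ((Module.AEval'.of A).symm (φ.symm (DirectSum.of _ i q))) = 0 := by
        rw [sub_algebraMap_pow_apply, ← map_smul φ.symm, ← DirectSum.lof_eq_of (Polynomial ℂ),
          ← map_smul, hq, map_zero, map_zero, map_zero]
      generalize (Module.AEval'.of A).symm _ = v at hker ⊢
      -- Exponent 0 gives a trivial summand, which is not an elementary divisor and contributes only
      -- the zero vector.
      rcases Nat.eq_zero_or_pos (e i) with h | h
      · rw [h, pow_zero, Module.End.one_apply] at hker
        rw [hker]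
        exact h0
      · exact hi i h _ hker
  simpa using key (φ (Module.AEval'.of A v))

/-- The witness is the class of 1 in the i-th summand, whose annihilator is generated by (X - w
i)^(e i). -/
theorem exists_vector_of_exact_order (i : ι) :
    ∃ v : V, ∀ k, ((A - algebraMap ℂ (Module.End ℂ V) (w i)) ^ k) v = 0 ↔ e i ≤ k := by
  classical
  refine ⟨(Module.AEval'.of A).symm (φ.symm (DirectSum.lof (Polynomial ℂ) ι _ i
    (Submodule.Quotient.mk 1))), fun k => ?_⟩
  rw [sub_algebraMap_pow_apply, ← map_smul φ.symm, ← map_smul, ← Submodule.Quotient.mk_smul]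
  simp only [LinearEquiv.map_eq_zero_iff, smul_eq_mul, mul_one]
  rw [DirectSum.lof_eq_of, map_eq_zero_iff _ (DirectSum.of_injective i), Submodule.Quotient.mk_eq_zero,
    Ideal.mem_span_singleton]
  exact pow_dvd_pow_iff (Polynomial.X_sub_C_ne_zero _) (Polynomial.not_isUnit_X_sub_C _)

theorem exponent_le_finrank [FiniteDimensional ℂ V] (i : ι) : e i ≤ Module.finrank ℂ V := by
  obtain ⟨v, hv⟩ := exists_vector_of_exact_order φ i
  have h : v ∈ A.genEigenspace (w i) (e i) := by
    rw [Module.End.mem_genEigenspace_nat, LinearMap.mem_ker]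
    exact (hv _).2 le_rfl
  have h' := Module.End.genEigenspace_le_genEigenspace_finrank A (w i) _ h
  rw [Module.End.mem_genEigenspace_nat, LinearMap.mem_ker] at h'
  exact (hv _).1 h'

theorem hasEigenvalue_of_exponent_pos {i : ι} (hi : 0 < e i) : A.HasEigenvalue (w i) := by
  obtain ⟨v, hv⟩ := exists_vector_of_exact_order φ i
  have hv0 : v ≠ 0 := by
    intro h
    have := (hv 0).1 (by simp [h])
    omega
  refine Module.End.hasEigenvalue_of_hasGenEigenvalue (k := e i) ?_
  rw [Module.End.hasGenEigenvalue_iff]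
  intro hbot
  refine hv0 ((Submodule.mem_bot ℂ).1 (hbot ▸ ?_))
  rw [Module.End.mem_genEigenspace_nat, LinearMap.mem_ker]
  exact (hv _).2 le_rfl

/-- If z were none of the w i of positive exponent, every vector would be killed by some p(A) with
p(z) ≠ 0; but p(A) acts on an eigenvector for z as the scalar p(z). -/
theorem exists_exponent_of_hasEigenvalue {z : ℂ} (hz : A.HasEigenvalue z) :
    ∃ i, 0 < e i ∧ w i = z := by
  by_contra! hne
  obtain ⟨v, hv⟩ := hz.exists_hasEigenvector
  obtain ⟨p, hp, hpv⟩ : ∃ p : Polynomial ℂ, p.eval z ≠ 0 ∧ Polynomial.aeval A p v = 0 := by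
    refine primary_induction φ (P := fun v => ∃ p : Polynomial ℂ, p.eval z ≠ 0 ∧
      Polynomial.aeval A p v = 0) ⟨1, by simp, by simp⟩ ?_ ?_ v
    · rintro v v' ⟨p, hp, hpv⟩ ⟨q, hq, hqv⟩
      refine ⟨p * q, by simp [hp, hq], ?_⟩
      rw [map_add, map_mul, Module.End.mul_apply, Module.End.mul_apply, hqv, map_zero, add_zero,
        ← Module.End.mul_apply, ← map_mul, mul_comm, map_mul, Module.End.mul_apply, hpv, map_zero]
    · intro i hi v hv
      refine ⟨(Polynomial.X - Polynomial.C (w i)) ^ e i, ?_, by simpa using hv⟩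
      simpa using fun h => absurd (sub_eq_zero.1 h).symm (hne i hi)
  rw [Module.End.aeval_apply_of_hasEigenvector hv] at hpv
  exact (smul_ne_zero hp hv.2) hpv

end PrimaryDecomposition

/-! ### Elementary divisors and extremal real parts -/

section ElementaryDivisors

variable {n : ℕ} (C : Matrix (Fin n) (Fin n) ℝ)

/-- The bound by the dimension is essential: `sSup` of an unbounded set of naturals is 0. -/
theorem IsElementaryDivisor.le_maxElemDivDegree {C : Matrix (Fin n) (Fin n) ℝ} {z : ℂ} {k : ℕ}
    (h : IsElementaryDivisor C z k) : k ≤ maxElemDivDegree C z.re := by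
  refine le_csSup ⟨Module.finrank ℂ (Fin n → ℂ), ?_⟩ ⟨z, rfl, h⟩
  rintro k ⟨z, -, -, ι, _, w, e, ⟨φ⟩, i, rfl, rfl⟩
  exact exponent_le_finrank φ i

theorem IsElementaryDivisor.hasEigenvalue {C : Matrix (Fin n) (Fin n) ℝ} {z : ℂ} {k : ℕ}
    (h : IsElementaryDivisor C z k) : (complexEnd C).HasEigenvalue z := by
  obtain ⟨hk, ι, _, w, e, ⟨φ⟩, i, rfl, rfl⟩ := h
  exact hasEigenvalue_of_exponent_pos φ hk

theorem exists_isElementaryDivisor_of_hasEigenvalue {z : ℂ}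
    (hz : (complexEnd C).HasEigenvalue z) : ∃ k, IsElementaryDivisor C z k := by
  obtain ⟨ι, hι, w, e, ⟨φ⟩⟩ := exists_primary_cyclic_decomposition (complexEnd C)
  obtain ⟨i, hi, hw⟩ := exists_exponent_of_hasEigenvalue φ hz
  exact ⟨e i, hi, ι, hι, w, e, ⟨φ⟩, i, hw, rfl⟩

theorem finite_eigenRealParts : (eigenRealParts C).Finite := by
  refine ((Module.End.finite_hasEigenvalue (complexEnd C)).image Complex.re).subset ?_
  rintro _ ⟨z, hz, rfl⟩
  exact ⟨z, hz, rfl⟩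

theorem nonempty_eigenRealParts (hn : 1 ≤ n) : (eigenRealParts C).Nonempty := by
  have : Nonempty (Fin n) := ⟨⟨0, hn⟩⟩
  obtain ⟨z, hz⟩ := Module.End.exists_eigenvalue (complexEnd C)
  exact ⟨z.re, z, hz, rfl⟩

theorem one_le_maxElemDivDegree {ρ : ℝ} (hρ : ρ ∈ eigenRealParts C) :
    1 ≤ maxElemDivDegree C ρ := by
  obtain ⟨z, hz, rfl⟩ := hρ
  obtain ⟨k, hk⟩ := exists_isElementaryDivisor_of_hasEigenvalue C hz
  exact hk.1.trans_le hk.le_maxElemDivDegree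

theorem IsElementaryDivisor.re_le_maxRe {C : Matrix (Fin n) (Fin n) ℝ} {z : ℂ} {k : ℕ}
    (h : IsElementaryDivisor C z k) : z.re ≤ maxRe C :=
  le_csSup (finite_eigenRealParts C).bddAbove ⟨z, h.hasEigenvalue, rfl⟩

theorem IsElementaryDivisor.minRe_le_re {C : Matrix (Fin n) (Fin n) ℝ} {z : ℂ} {k : ℕ}
    (h : IsElementaryDivisor C z k) : minRe C ≤ z.re :=
  csInf_le (finite_eigenRealParts C).bddBelow ⟨z, h.hasEigenvalue, rfl⟩

end ElementaryDivisors

/-! ### Growth of the matrix exponential -/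

section ExponentialGrowth

theorem hasSum_exp_apply {𝕜 E : Type*} [RCLike 𝕜] [NormedAddCommGroup E] [NormedSpace 𝕜 E]
    [CompleteSpace E] (S : E →L[𝕜] E) (x : E) :
    HasSum (fun k : ℕ => (k.factorial⁻¹ : 𝕜) • (S ^ k) x) (NormedSpace.exp S x) := by
  let _ : NormedAlgebra ℚ (E →L[𝕜] E) := NormedAlgebra.restrictScalars ℚ 𝕜 _
  simpa using (NormedSpace.exp_series_hasSum_exp' (𝕂 := 𝕜) S).mapL
    (ContinuousLinearMap.apply 𝕜 E x)

/-- Write S = w + N with commuting summands; the exponential series of sN at v stops because N^e v =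
0. -/
theorem exp_smul_apply_of_pow_sub_smul_apply_eq_zero {E : Type*} [NormedAddCommGroup E]
    [NormedSpace ℂ E] [CompleteSpace E] (S : E →L[ℂ] E) (w s : ℂ) {e : ℕ} {v : E}
    (hv : ((S - algebraMap ℂ (E →L[ℂ] E) w) ^ e) v = 0) :
    NormedSpace.exp (s • S) v = Complex.exp (s * w) • ∑ k ∈ Finset.range e,
      (k.factorial⁻¹ : ℂ) • s ^ k • ((S - algebraMap ℂ (E →L[ℂ] E) w) ^ k) v := by
  let _ : NormedAlgebra ℚ (E →L[ℂ] E) := NormedAlgebra.restrictScalars ℚ ℂ _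
  set N := S - algebraMap ℂ (E →L[ℂ] E) w with hN
  have hS : s • S = algebraMap ℂ (E →L[ℂ] E) (s * w) + s • N := by
    rw [hN, map_mul, ← Algebra.smul_def, smul_sub, add_sub_cancel]
  rw [hS, NormedSpace.exp_add_of_commute (Algebra.commutes _ _), ← NormedSpace.algebraMap_exp_comm,
    ← Complex.exp_eq_exp_ℂ, ← Algebra.smul_def, smul_apply]
  congr 1
  refine (hasSum_exp_apply (s • N) v).unique ?_
  have hterm : ∀ k : ℕ, (k.factorial⁻¹ : ℂ) • ((s • N) ^ k) v =
      (k.factorial⁻¹ : ℂ) • s ^ k • (N ^ k) v := fun k => by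
    rw [smul_pow, smul_apply]
  simp only [hterm]
  refine hasSum_sum_of_ne_finset_zero fun k hk => ?_
  obtain ⟨j, rfl⟩ := Nat.exists_eq_add_of_le' (not_lt.1 fun h => hk (Finset.mem_range.2 h))
  rw [pow_add N, mul_apply_eq_comp, hv, map_zero, smul_zero, smul_zero]

theorem exists_norm_exp_smul_apply_le {E : Type*} [NormedAddCommGroup E]
    [NormedSpace ℂ E] [CompleteSpace E] (S : E →L[ℂ] E) (w : ℂ) {e : ℕ} {v : E}
    (hv : ((S - algebraMap ℂ (E →L[ℂ] E) w) ^ e) v = 0) :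
    ∃ K : ℝ, 0 ≤ K ∧ ∀ s : ℝ, 1 ≤ |s| →
      ‖NormedSpace.exp ((s : ℂ) • S) v‖ ≤ K * (|s| ^ (e - 1) * Real.exp (w.re * s)) := by
  refine ⟨∑ k ∈ Finset.range e, ‖((S - algebraMap ℂ (E →L[ℂ] E) w) ^ k) v‖,
    Finset.sum_nonneg fun _ _ => norm_nonneg _, fun s hs => ?_⟩
  rw [exp_smul_apply_of_pow_sub_smul_apply_eq_zero S w s hv, norm_smul, Complex.norm_exp,
    show ((s : ℂ) * w).re = w.re * s by simp [mul_comm], mul_comm, ← mul_assoc]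
  refine mul_le_mul_of_nonneg_right ?_ (Real.exp_nonneg _)
  rw [Finset.sum_mul]
  refine norm_sum_le_of_le _ fun k hk => ?_
  rw [norm_smul, norm_smul, norm_pow, Complex.norm_real, Real.norm_eq_abs, norm_inv,
    Complex.norm_natCast, mul_comm _ (|s| ^ (e - 1))]
  have h1 : ((k.factorial : ℝ))⁻¹ ≤ 1 :=
    inv_le_one_of_one_le₀ (by exact_mod_cast k.factorial_pos)
  have h2 : |s| ^ k ≤ |s| ^ (e - 1) :=
    pow_le_pow_right₀ hs (by have := Finset.mem_range.1 hk; omega)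
  have h3 : 0 ≤ |s| ^ k * ‖((S - algebraMap ℂ (E →L[ℂ] E) w) ^ k) v‖ := by positivity
  calc _ ≤ 1 * (|s| ^ k * ‖((S - algebraMap ℂ (E →L[ℂ] E) w) ^ k) v‖) :=
        mul_le_mul_of_nonneg_right h1 h3
    _ ≤ _ := by
        rw [one_mul]
        exact mul_le_mul_of_nonneg_right h2 (norm_nonneg _)

variable {n : ℕ} (C : Matrix (Fin n) (Fin n) ℝ)

/-- The endomorphism `complexEnd C` as a continuous linear map. -/
def complexAct : (Fin n → ℂ) →L[ℂ] (Fin n → ℂ) :=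
  LinearMap.toContinuousLinearMap (complexEnd C)

/-- The inclusion of Euclidean `ℝⁿ` into `ℂⁿ`. -/
def complexify : EuclideanSpace ℝ (Fin n) →L[ℝ] (Fin n → ℂ) :=
  LinearMap.toContinuousLinearMap
    { toFun := fun x i => (x i : ℂ)
      map_add' := fun x y => by ext i; simp
      map_smul' := fun c x => by ext i; simp }

theorem complexify_apply (x : EuclideanSpace ℝ (Fin n)) (i : Fin n) :
    complexify x i = (x i : ℂ) := rfl

theorem complexify_act (x : EuclideanSpace ℝ (Fin n)) :
    complexify (act C x) = complexAct C (complexify x) := by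
  ext i
  simp [complexify_apply, act, complexAct, complexEnd, Matrix.mulVec, dotProduct,
    Matrix.toLin'_apply]

/-- Carries growth bounds obtained over ℂ, where the primary decomposition lives, back to the real
exponential. -/
theorem complexify_expAct (t : ℝ) (x : EuclideanSpace ℝ (Fin n)) :
    complexify (expAct C t x) = NormedSpace.exp ((t : ℂ) • complexAct C) (complexify x) := by
  have hpow : ∀ k : ℕ, complexify (((t • act C) ^ k) x) =
      (((t : ℂ) • complexAct C) ^ k) (complexify x) := by
    intro k
    induction k with
    | zero => simp
    | succ k ih =>
      rw [pow_succ', pow_succ', mul_apply_eq_comp, mul_apply_eq_comp, ← ih,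
        smul_apply, smul_apply, map_smul, complexify_act]
      simp
  have h1 := (hasSum_exp_apply (t • act C) x).mapL complexify
  have h2 := hasSum_exp_apply ((t : ℂ) • complexAct C) (complexify x)
  have hterm : ∀ k : ℕ, complexify ((k.factorial⁻¹ : ℝ) • ((t • act C) ^ k) x) =
      (k.factorial⁻¹ : ℂ) • (((t : ℂ) • complexAct C) ^ k) (complexify x) := fun k => by
    rw [map_smul, hpow]
    ext i
    simp
  simp only [hterm] at h1
  exact HasSum.unique h1 h2

theorem exists_norm_le_mul_norm_complexify :
    ∃ K : ℝ, 0 ≤ K ∧ ∀ x : EuclideanSpace ℝ (Fin n), ‖x‖ ≤ K * ‖complexify x‖ := by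
  have hinj : LinearMap.ker (complexify (n := n) : EuclideanSpace ℝ (Fin n) →ₗ[ℝ] (Fin n → ℂ)) = ⊥ := by
    rw [LinearMap.ker_eq_bot']
    intro x hx
    ext i
    have := congrFun hx i
    simpa [complexify_apply] using this
  obtain ⟨K, -, hK⟩ := LinearMap.exists_antilipschitzWith _ hinj
  exact ⟨K, K.2, fun x => by simpa using hK.le_mul_dist x 0⟩

/-- If `g` dominates `t^(k-1) e^{±Re z t}` for every elementary divisor `(X - z)^k` then `g`
dominates the norm of `e^{±Ct}`. -/
theorem exists_norm_expAct_le_of_elementaryDivisors {σ : ℝ} (hσ : |σ| = 1) {g : ℝ → ℝ}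
    (hg : ∀ t, 1 ≤ t → 0 < g t)
    (hdom : ∀ z k, IsElementaryDivisor C z k →
      ∃ K : ℝ, ∀ t, 1 ≤ t → t ^ (k - 1) * Real.exp (z.re * (σ * t)) ≤ K * g t) :
    ∃ K : ℝ, ∀ t, 1 ≤ t → ‖expAct C (σ * t)‖ ≤ K * g t := by
  have hcomplex : ∀ v : Fin n → ℂ, ∃ K : ℝ, ∀ t : ℝ, 1 ≤ t →
      ‖NormedSpace.exp (((σ * t : ℝ) : ℂ) • complexAct C) v‖ ≤ K * g t := by
    obtain ⟨ι, hι, w, e, ⟨φ⟩⟩ := exists_primary_cyclic_decomposition (complexEnd C)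
    refine primary_induction φ (P := fun v => ∃ K : ℝ, ∀ t : ℝ, 1 ≤ t →
      ‖NormedSpace.exp (((σ * t : ℝ) : ℂ) • complexAct C) v‖ ≤ K * g t) ⟨0, by simp⟩ ?_ ?_
    · rintro v v' ⟨K, hK⟩ ⟨K', hK'⟩
      refine ⟨K + K', fun t ht => ?_⟩
      rw [map_add, add_mul]
      exact norm_add_le_of_le (hK t ht) (hK' t ht)
    · intro i hi v hv
      have hv' : ((complexAct C - algebraMap ℂ _ (w i)) ^ e i) v = 0 := by
        have hcoe : ((complexAct C - algebraMap ℂ ((Fin n → ℂ) →L[ℂ] (Fin n → ℂ)) (w i) :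
            (Fin n → ℂ) →L[ℂ] (Fin n → ℂ)) : Module.End ℂ (Fin n → ℂ)) =
            complexEnd C - algebraMap ℂ (Module.End ℂ (Fin n → ℂ)) (w i) := rfl
        rw [← hcoe, ← ContinuousLinearMap.toLinearMap_pow] at hv
        exact hv
      obtain ⟨K, hK0, hK⟩ := exists_norm_exp_smul_apply_le _ _ hv'
      obtain ⟨K', hK'⟩ := hdom (w i) (e i) ⟨hi, ι, hι, w, e, ⟨φ⟩, i, rfl, rfl⟩
      refine ⟨K * K', fun t ht => ?_⟩
      have habs : |σ * t| = t := by rw [abs_mul, hσ, one_mul, abs_of_nonneg (by linarith)]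
      refine (hK (σ * t) (by rwa [habs])).trans ?_
      rw [habs, mul_assoc]
      exact mul_le_mul_of_nonneg_left (hK' t ht) hK0
  obtain ⟨K₀, hK₀, hιle⟩ := exists_norm_le_mul_norm_complexify (n := n)
  -- The bounds so far depend on the vector; uniform boundedness of the operators e^{σCt}/g(t) turns
  -- them into a bound on the operator norm.
  obtain ⟨K, hK⟩ := banach_steinhaus
    (g := fun t : Ici (1 : ℝ) => (g t)⁻¹ • expAct C (σ * t)) (by
      intro x
      obtain ⟨K, hK⟩ := hcomplex (complexify x)
      refine ⟨K₀ * K, fun ⟨t, ht⟩ => ?_⟩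
      have hgt := hg t ht
      have h := (hιle (expAct C (σ * t) x)).trans (mul_le_mul_of_nonneg_left
        ((complexify_expAct C (σ * t) x).symm ▸ hK t ht) hK₀)
      rw [smul_apply, norm_smul, norm_inv, Real.norm_of_nonneg hgt.le,
        inv_mul_le_iff₀ hgt]
      linarith)
  refine ⟨K, fun t ht => ?_⟩
  have hgt := hg t ht
  have h := hK ⟨t, ht⟩
  rw [norm_smul, norm_inv, Real.norm_of_nonneg hgt.le, inv_mul_le_iff₀ hgt] at h
  linarith

theorem exists_pow_mul_exp_le {δ : ℝ} (hδ : 0 < δ) (k : ℕ) :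
    ∃ K : ℝ, ∀ t, 1 ≤ t → t ^ k ≤ K * Real.exp (δ * t) := by
  refine ⟨k.factorial / δ ^ k, fun t ht => ?_⟩
  have h := Real.pow_div_factorial_le_exp (δ * t) (by positivity) k
  have hk : (0 : ℝ) < k.factorial := by positivity
  have hd : 0 < δ ^ k := by positivity
  rw [div_le_iff₀ hk, mul_pow] at h
  rw [div_mul_eq_mul_div, le_div_iff₀ hd]
  linarith

/-- A lower exponential rate absorbs any power; at an equal rate the powers are compared. -/
theorem exists_pow_mul_exp_le_pow_mul_exp {a b : ℝ} {k m : ℕ} (hab : a ≤ b)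
    (hkm : a = b → k ≤ m) :
    ∃ K : ℝ, ∀ t, 1 ≤ t → t ^ k * Real.exp (a * t) ≤ K * (t ^ m * Real.exp (b * t)) := by
  rcases hab.eq_or_lt with rfl | hlt
  · refine ⟨1, fun t ht => ?_⟩
    rw [one_mul]
    exact mul_le_mul_of_nonneg_right (pow_le_pow_right₀ ht (hkm rfl)) (Real.exp_nonneg _)
  · obtain ⟨K, hK⟩ := exists_pow_mul_exp_le (sub_pos.2 hlt) k
    refine ⟨K, fun t ht => ?_⟩
    have hexp : Real.exp (b * t) = Real.exp ((b - a) * t) * Real.exp (a * t) := by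
      rw [← Real.exp_add]
      ring_nf
    have h1 : t ^ k * Real.exp (a * t) ≤ K * Real.exp (b * t) := by
      rw [hexp, ← mul_assoc]
      exact mul_le_mul_of_nonneg_right (hK t ht) (Real.exp_nonneg _)
    -- The sign of K is not given; it is read off from the estimate itself.
    have h0 : 0 ≤ K * Real.exp (b * t) := le_trans (by positivity) h1
    calc _ ≤ K * Real.exp (b * t) := h1
      _ ≤ t ^ m * (K * Real.exp (b * t)) := le_mul_of_one_le_left h0 (one_le_pow₀ ht)
      _ = _ := by ring

theorem exists_norm_expAct_le : ∃ K : ℝ, ∀ t, 1 ≤ t →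
    ‖expAct C t‖ ≤ K * (t ^ (maxElemDivDegree C (maxRe C) - 1) * Real.exp (maxRe C * t)) := by
  have h := exists_norm_expAct_le_of_elementaryDivisors C (σ := 1) (by simp)
    (g := fun t => t ^ (maxElemDivDegree C (maxRe C) - 1) * Real.exp (maxRe C * t))
    (fun t ht => by positivity) (fun z k hz => by
      simp only [one_mul]
      refine exists_pow_mul_exp_le_pow_mul_exp hz.re_le_maxRe fun h => ?_
      exact Nat.sub_le_sub_right (h ▸ hz.le_maxElemDivDegree) 1)
  simpa only [one_mul] using h

theorem exists_norm_expAct_neg_le : ∃ K : ℝ, ∀ t, 1 ≤ t →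
    ‖expAct C (-t)‖ ≤ K * (t ^ (maxElemDivDegree C (minRe C) - 1) * Real.exp (-minRe C * t)) := by
  have h := exists_norm_expAct_le_of_elementaryDivisors C (σ := -1) (by simp)
    (g := fun t => t ^ (maxElemDivDegree C (minRe C) - 1) * Real.exp (-minRe C * t))
    (fun t ht => by positivity) (fun z k hz => by
      simp only [neg_one_mul, mul_neg, ← neg_mul]
      refine exists_pow_mul_exp_le_pow_mul_exp (neg_le_neg hz.minRe_le_re) fun h => ?_
      exact Nat.sub_le_sub_right (neg_injective h ▸ hz.le_maxElemDivDegree) 1)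
  simpa only [neg_one_mul] using h

theorem exists_norm_expAct_neg_mul_norm_expAct_le (hn : 1 ≤ n) : ∃ K : ℝ, ∀ t, 1 ≤ t →
    ‖expAct C (-t)‖ * ‖expAct C t‖ ≤
      K * (t ^ (maxElemDivDegree C (maxRe C) + maxElemDivDegree C (minRe C) - 2) *
        Real.exp ((maxRe C - minRe C) * t)) := by
  obtain ⟨K, hK⟩ := exists_norm_expAct_le C
  obtain ⟨K', hK'⟩ := exists_norm_expAct_neg_le C
  -- Both degrees are at least 1, so the truncated subtractions satisfy m_β + m_α - 2 = (m_β - 1) +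
  -- (m_α - 1).
  have hmax := one_le_maxElemDivDegree C
    ((nonempty_eigenRealParts C hn).csSup_mem (finite_eigenRealParts C))
  have hmin := one_le_maxElemDivDegree C
    ((nonempty_eigenRealParts C hn).csInf_mem (finite_eigenRealParts C))
  refine ⟨K' * K, fun t ht => ?_⟩
  refine (mul_le_mul (hK' t ht) (hK t ht) (norm_nonneg _)
    ((norm_nonneg _).trans (hK' t ht))).trans_eq ?_
  have hexp : Real.exp ((maxRe C - minRe C) * t) =
      Real.exp (maxRe C * t) * Real.exp (-minRe C * t) := by
    rw [← Real.exp_add]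
    ring_nf
  have hpow : maxElemDivDegree C (maxRe C) + maxElemDivDegree C (minRe C) - 2 =
      (maxElemDivDegree C (maxRe C) - 1) + (maxElemDivDegree C (minRe C) - 1) := by
    change 1 ≤ maxElemDivDegree C (maxRe C) at hmax
    change 1 ≤ maxElemDivDegree C (minRe C) at hmin
    omega
  rw [hexp, hpow, pow_add]
  ring

end ExponentialGrowth

/-! ### Boundedness and limits from integrable derivative bounds -/

section AsymptoticIntegration

variable {E : Type*} [NormedAddCommGroup E] [NormedSpace ℝ E] [CompleteSpace E]
  {u F : ℝ → E} {a : ℝ}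

theorem sub_eq_intervalIntegral (hu : ∀ t ∈ Ici a, HasDerivWithinAt u (F t) (Ici a) t)
    (hF : ContinuousOn F (Ici a)) {s t : ℝ} (hs : a ≤ s) (hst : s ≤ t) :
    ∫ x in s..t, F x = u t - u s := by
  have hsub : Icc s t ⊆ Ici a := fun x hx => hs.trans hx.1
  refine intervalIntegral.integral_eq_sub_of_hasDerivAt_of_le hst
    (fun x hx => ((hu x (hsub hx)).continuousWithinAt.mono hsub)) (fun x hx => ?_)
    (ContinuousOn.intervalIntegrable (by rw [uIcc_of_le hst]; exact hF.mono hsub))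
  exact (hu x (hsub (Ioo_subset_Icc_self hx))).hasDerivAt (Ici_mem_nhds (hs.trans_lt hx.1))

/-- If `‖u'‖ ≤ g ‖u‖` with `g` integrable at infinity then `u` is bounded. -/
theorem exists_norm_le_of_norm_deriv_le_mul_norm {g : ℝ → ℝ}
    (hu : ∀ t ∈ Ici a, HasDerivWithinAt u (F t) (Ici a) t) (hF : ContinuousOn F (Ici a))
    (hg : IntegrableOn g (Ioi a)) (hg0 : ∀ t ∈ Ici a, 0 ≤ g t)
    (hFg : ∀ t ∈ Ici a, ‖F t‖ ≤ g t * ‖u t‖) : ∃ M : ℝ, ∀ t ∈ Ici a, ‖u t‖ ≤ M := by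
  have hcont : ContinuousOn u (Ici a) := fun t ht => (hu t ht).continuousWithinAt
  -- Beyond T the integral of g is below 1/2. At a maximum point s of ‖u‖ on [T, t] this gives ‖u s‖
  -- ≤ ‖u T‖ + ‖u s‖/2; absorbing the last term yields the factor 2.
  obtain ⟨T, hT, haT⟩ : ∃ T, (∫ x in Ioi T, g x) < 1 / 2 ∧ a ≤ T := by
    have h : Tendsto (fun T => ∫ x in Ioi T, g x) atTop (𝓝 0) :=
      tendsto_integral_Ioi_zero tendsto_id
    exact ((h.eventually (gt_mem_nhds (by norm_num))).and (eventually_ge_atTop a)).exists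
  have htail : ∀ t ∈ Ici T, ‖u t‖ ≤ 2 * ‖u T‖ := by
    intro t ht
    have hTa : Icc T t ⊆ Ici a := fun x hx => haT.trans hx.1
    obtain ⟨s, hs, hmax⟩ := isCompact_Icc.exists_isMaxOn ⟨t, ht, le_rfl⟩
      (hcont.mono hTa).norm
    have hgT : IntegrableOn g (Ioi T) := hg.mono_set (Ioi_subset_Ioi haT)
    have hgs : IntervalIntegrable g volume T s :=
      (intervalIntegrable_iff_integrableOn_Ioc_of_le hs.1).2 (hgT.mono_set Ioc_subset_Ioi_self)
    have hint : ‖u s - u T‖ ≤ ∫ x in T..s, g x * ‖u s‖ := by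
      rw [← sub_eq_intervalIntegral hu hF haT hs.1]
      refine intervalIntegral.norm_integral_le_of_norm_le hs.1 (ae_of_all _ fun x hx => ?_)
        (hgs.mul_const _)
      have hx' : x ∈ Icc T t := ⟨hx.1.le, hx.2.trans hs.2⟩
      exact (hFg x (hTa hx')).trans (mul_le_mul_of_nonneg_left (hmax hx') (hg0 x (hTa hx')))
    have hle : ∫ x in T..s, g x ≤ ∫ x in Ioi T, g x := by
      rw [intervalIntegral.integral_of_le hs.1]
      refine setIntegral_mono_set hgT ?_ Ioc_subset_Ioi_self.eventuallyLE
      exact (ae_restrict_iff' measurableSet_Ioi).2 (ae_of_all _ fun x hx => hg0 x (haT.trans hx.le))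
    rw [intervalIntegral.integral_mul_const] at hint
    have h1 : (∫ x in T..s, g x) * ‖u s‖ ≤ 1 / 2 * ‖u s‖ :=
      mul_le_mul_of_nonneg_right (hle.trans hT.le) (norm_nonneg _)
    have h2 : ‖u s‖ ≤ ‖u T‖ + ‖u s - u T‖ := norm_le_norm_add_norm_sub' _ _
    have h3 : ‖u t‖ ≤ ‖u s‖ := hmax (show t ∈ Icc T t from ⟨ht, le_rfl⟩)
    linarith
  obtain ⟨M, hM⟩ := (isCompact_Icc (a := a) (b := T)).exists_bound_of_continuousOn
    (hcont.mono Icc_subset_Ici_self)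
  refine ⟨max M (2 * ‖u T‖), fun t ht => ?_⟩
  rcases le_total t T with h | h
  · exact (hM t ⟨ht, h⟩).trans (le_max_left _ _)
  · exact (htail t h).trans (le_max_right _ _)

theorem exists_tendsto_of_integrableOn_deriv
    (hu : ∀ t ∈ Ici a, HasDerivWithinAt u (F t) (Ici a) t) (hF : IntegrableOn F (Ioi a)) :
    ∃ c, Tendsto u atTop (𝓝 c) ∧ ∀ t ∈ Ici a, ∫ x in Ioi t, F x = c - u t := by
  have hderiv : ∀ t ∈ Ioi a, HasDerivAt u (F t) t := fun t ht =>
    (hu t (Ioi_subset_Ici_self ht)).hasDerivAt (Ici_mem_nhds ht)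
  have hlim := tendsto_limUnder_of_hasDerivAt_of_integrableOn_Ioi hderiv hF
  refine ⟨_, hlim, fun t ht => ?_⟩
  have hsub : Ioi t ⊆ Ioi a := Ioi_subset_Ioi ht
  exact integral_Ioi_of_hasDerivAt_of_tendsto
    ((hu t ht).continuousWithinAt.mono (Ici_subset_Ici.2 ht)) (fun x hx => hderiv x (hsub hx))
    (hF.mono_set hsub) hlim

end AsymptoticIntegration

/-! ### Inverse and derivative of the operator exponential -/

section OperatorExponential

variable {E : Type*} [NormedAddCommGroup E] [NormedSpace ℝ E] [CompleteSpace E]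

theorem exp_smul_apply_exp_neg_smul (S : E →L[ℝ] E) (t : ℝ) (x : E) :
    NormedSpace.exp (t • S) (NormedSpace.exp ((-t) • S) x) = x := by
  let _ : NormedAlgebra ℚ (E →L[ℝ] E) := NormedAlgebra.restrictScalars ℚ ℝ _
  have h : NormedSpace.exp (t • S) * NormedSpace.exp ((-t) • S) = 1 := by
    rw [neg_smul, ← NormedSpace.exp_add_of_commute (Commute.refl _).neg_right,
      add_neg_cancel, NormedSpace.exp_zero]
  exact DFunLike.congr_fun h x

theorem hasDerivAt_exp_neg_smul (S : E →L[ℝ] E) (t : ℝ) :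
    HasDerivAt (fun s : ℝ => NormedSpace.exp ((-s) • S))
      (-(NormedSpace.exp ((-t) • S) * S)) t := by
  have h := hasDerivAt_exp_smul_const (𝕂 := ℝ) (-S) t
  simpa only [smul_neg, ← neg_smul, mul_neg] using h

end OperatorExponential

/-! ### Solutions of the transformed equation -/

section Solutions

variable {n : ℕ} (C : Matrix (Fin n) (Fin n) ℝ)

theorem continuous_expAct : Continuous (expAct C) := by
  let _ : NormedAlgebra ℚ (EuclideanSpace ℝ (Fin n) →L[ℝ] EuclideanSpace ℝ (Fin n)) :=
    NormedAlgebra.restrictScalars ℚ ℝ _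
  exact NormedSpace.exp_continuous.comp (continuous_id.smul continuous_const)

theorem expAct_apply_expAct_neg (t : ℝ) (x : EuclideanSpace ℝ (Fin n)) :
    expAct C t (expAct C (-t) x) = x :=
  exp_smul_apply_exp_neg_smul (act C) t x

theorem hasDerivAt_expAct_neg (t : ℝ) :
    HasDerivAt (fun s => expAct C (-s)) (-(expAct C (-t) * act C)) t :=
  hasDerivAt_exp_neg_smul (act C) t

variable {C} {f : ℝ → EuclideanSpace ℝ (Fin n) → EuclideanSpace ℝ (Fin n)} {t₀ : ℝ}

theorem continuousOn_transformedField (hf : Continuous (Function.uncurry f))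
    {u : ℝ → EuclideanSpace ℝ (Fin n)} {s : Set ℝ} (hu : ContinuousOn u s) :
    ContinuousOn (fun t => transformedField C f t (u t)) s := by
  have h1 : ContinuousOn (fun t => expAct C t (u t)) s :=
    (continuous_expAct C).continuousOn.clm_apply hu
  have h2 : ContinuousOn (fun t => f t (expAct C t (u t))) s :=
    hf.comp_continuousOn (continuousOn_id.prodMk h1)
  exact ((continuous_expAct C).comp continuous_neg).continuousOn.clm_apply h2

theorem norm_transformedField_le (hf0 : ∀ t, f t 0 = 0) {η : ℝ → ℝ} (hη : LipschitzCond f η)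
    {t : ℝ} (ht : 0 ≤ t) (x : EuclideanSpace ℝ (Fin n)) :
    ‖transformedField C f t x‖ ≤ ‖expAct C (-t)‖ * ‖expAct C t‖ * η t * ‖x‖ := by
  have h := hη.2 t ht (expAct C t x) 0
  rw [hf0, sub_zero, sub_zero] at h
  calc ‖transformedField C f t x‖ ≤ ‖expAct C (-t)‖ * ‖f t (expAct C t x)‖ :=
        ContinuousLinearMap.le_opNorm _ _
    _ ≤ ‖expAct C (-t)‖ * (η t * (‖expAct C t‖ * ‖x‖)) :=
        mul_le_mul_of_nonneg_left (h.trans (mul_le_mul_of_nonneg_left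
          (ContinuousLinearMap.le_opNorm _ _) (hη.1 t ht))) (norm_nonneg _)
    _ = _ := by ring

theorem IsSolutionOn.bounded_and_integrableOn (hn : 1 ≤ n)
    (hf : Continuous (Function.uncurry f)) (hf0 : ∀ t, f t 0 = 0) {η : ℝ → ℝ}
    (hη : LipschitzCond f η) (hint : WeightedIntegrableCond C η)
    {u : ℝ → EuclideanSpace ℝ (Fin n)} (hu : IsSolutionOn (transformedField C f) t₀ u) :
    (∃ M : ℝ, ∀ t ∈ Ici t₀, ‖u t‖ ≤ M) ∧
      IntegrableOn (fun t => transformedField C f t (u t)) (Ioi t₀) := by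
  set F := fun t => transformedField C f t (u t) with hFdef
  have hcont : ContinuousOn u (Ici t₀) := fun t ht => (hu t ht).continuousWithinAt
  have hF : ContinuousOn F (Ici t₀) := continuousOn_transformedField hf hcont
  obtain ⟨K, hK⟩ := exists_norm_expAct_neg_mul_norm_expAct_le C hn
  -- The growth bounds hold only for t ≥ 1; the compact interval [t₀, a] is covered by continuity.
  set a := max t₀ 1 with ha
  have hat : Ici a ⊆ Ici t₀ := Ici_subset_Ici.2 (le_max_left _ _)
  have ha1 : ∀ t ∈ Ici a, 1 ≤ t := fun t ht => (le_max_right _ _).trans ht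
  set g : ℝ → ℝ := fun t => K * (t ^ (maxElemDivDegree C (maxRe C) +
    maxElemDivDegree C (minRe C) - 2) * Real.exp ((maxRe C - minRe C) * t) * η t) with hg
  have hgint : IntegrableOn g (Ioi a) :=
    (hint.mono_set (Ioi_subset_Ioi (zero_le_one.trans (le_max_right _ _)))).const_mul K
  have hgle : ∀ t ∈ Ici a, ‖expAct C (-t)‖ * ‖expAct C t‖ * η t ≤ g t := fun t ht => by
    have h := mul_le_mul_of_nonneg_right (hK t (ha1 t ht))
      (hη.1 t (zero_le_one.trans (ha1 t ht)))
    simpa only [hg, mul_assoc] using h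
  have hg0 : ∀ t ∈ Ici a, 0 ≤ g t := fun t ht => le_trans
    (mul_nonneg (by positivity) (hη.1 t (zero_le_one.trans (ha1 t ht)))) (hgle t ht)
  have hFg : ∀ t ∈ Ici a, ‖F t‖ ≤ g t * ‖u t‖ := fun t ht =>
    (norm_transformedField_le hf0 hη (zero_le_one.trans (ha1 t ht)) (u t)).trans
      (mul_le_mul_of_nonneg_right (hgle t ht) (norm_nonneg _))
  obtain ⟨M, hM⟩ := exists_norm_le_of_norm_deriv_le_mul_norm
    (fun t ht => (hu t (hat ht)).mono hat) (hF.mono hat) hgint hg0 hFg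
  obtain ⟨M', hM'⟩ := (isCompact_Icc (a := t₀) (b := a)).exists_bound_of_continuousOn
    (hcont.mono Icc_subset_Ici_self)
  refine ⟨⟨max M' M, fun t ht => ?_⟩, ?_⟩
  · rcases le_total t a with h | h
    · exact (hM' t ⟨ht, h⟩).trans (le_max_left _ _)
    · exact (hM t h).trans (le_max_right _ _)
  · rw [← Ioc_union_Ioi_eq_Ioi (le_max_left t₀ 1)]
    refine IntegrableOn.union ?_ ?_
    · exact ((hF.mono Icc_subset_Ici_self).integrableOn_Icc).mono_set Ioc_subset_Icc_self
    -- Boundedness of u makes M·g an integrable majorant of F; measurability of F comes from its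
    -- continuity.
    · refine Integrable.mono' (hgint.mul_const M)
        ((hF.mono (Ioi_subset_Ici_self.trans hat)).aestronglyMeasurable measurableSet_Ioi) ?_
      refine (ae_restrict_iff' measurableSet_Ioi).2 (ae_of_all _ fun t ht => ?_)
      have ht' : t ∈ Ici a := Ioi_subset_Ici_self ht
      exact (hFg t ht').trans (mul_le_mul_of_nonneg_left (hM t ht') (hg0 t ht'))

/-- In the product rule the term -e^{-Ct}Cy cancels the linear part of the equation. -/
theorem IsSolutionOn.expAct_neg_apply {y : ℝ → EuclideanSpace ℝ (Fin n)}
    (hy : IsSolutionOn (quasilinearField C f) t₀ y) :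
    IsSolutionOn (transformedField C f) t₀ fun t => expAct C (-t) (y t) := by
  intro t ht
  have h := (hasDerivAt_expAct_neg C t).hasDerivWithinAt.clm_apply (hy t ht)
  have hderiv : (-(expAct C (-t) * act C)) (y t) + expAct C (-t) (quasilinearField C f t (y t)) =
      transformedField C f t (expAct C (-t) (y t)) := by
    rw [transformedField, expAct_apply_expAct_neg, quasilinearField, map_add]
    exact neg_add_cancel_left _ _
  exact hderiv ▸ h

end Solutions

end QuasilinearODE

end

/-! ### The asymptotic formula -/

theorem mainTheorem4 {n : ℕ} (hn : 1 ≤ n) (C : Matrix (Fin n) (Fin n) ℝ)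
    (f : ℝ → EuclideanSpace ℝ (Fin n) → EuclideanSpace ℝ (Fin n))
    (hf : Continuous (Function.uncurry f)) (hf0 : ∀ t, f t 0 = 0)
    (η : ℝ → ℝ) (hC3 : QuasilinearODE.LipschitzCond f η)
    (hC4 : QuasilinearODE.WeightedIntegrableCond C η)
    (t₀ : ℝ) (ht₀ : 0 ≤ t₀) :
    (∀ u : ℝ → EuclideanSpace ℝ (Fin n),
      QuasilinearODE.IsSolutionOn (QuasilinearODE.transformedField C f) t₀ u →
        (∃ M : ℝ, ∀ t ∈ Ici t₀, ‖u t‖ ≤ M) ∧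
        ∃ c : EuclideanSpace ℝ (Fin n), Tendsto u atTop (𝓝 c)) ∧
    (∀ y : ℝ → EuclideanSpace ℝ (Fin n),
      QuasilinearODE.IsSolutionOn (QuasilinearODE.quasilinearField C f) t₀ y →
        ∃ (c : EuclideanSpace ℝ (Fin n)) (r u : ℝ → EuclideanSpace ℝ (Fin n)),
          QuasilinearODE.IsSolutionOn (QuasilinearODE.transformedField C f) t₀ u ∧
          (∀ t ∈ Ici t₀, y t = QuasilinearODE.expAct C t (u t)) ∧
          Tendsto u atTop (𝓝 c) ∧
          (∀ t ∈ Ici t₀, y t = QuasilinearODE.expAct C t (c + r t)) ∧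
          Tendsto r atTop (𝓝 0) ∧
          ∀ t ∈ Ici t₀,
            IntegrableOn (fun s => QuasilinearODE.expAct C (-s)
              (f s (QuasilinearODE.expAct C s (u s)))) (Ioi t) ∧
            r t = -∫ s in Ioi t, QuasilinearODE.expAct C (-s)
              (f s (QuasilinearODE.expAct C s (u s)))) := by
  refine ⟨fun u hu => ?_, fun y hy => ?_⟩
  · obtain ⟨hM, hint⟩ := hu.bounded_and_integrableOn hn hf hf0 hC3 hC4
    obtain ⟨c, hc, -⟩ := QuasilinearODE.exists_tendsto_of_integrableOn_deriv hu hint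
    exact ⟨hM, c, hc⟩
  · have hu := hy.expAct_neg_apply
    obtain ⟨-, hint⟩ := hu.bounded_and_integrableOn hn hf hf0 hC3 hC4
    obtain ⟨c, hc, hr⟩ := QuasilinearODE.exists_tendsto_of_integrableOn_deriv hu hint
    -- Here u(t) = e^{-Ct}y(t) and r = u - c on the whole line, so r → 0 is immediate and the
    -- integral formula is the tail identity `hr`.
    refine ⟨c, fun t => QuasilinearODE.expAct C (-t) (y t) - c, _, hu,
      fun t _ => (QuasilinearODE.expAct_apply_expAct_neg C t (y t)).symm, hc, fun t _ => ?_,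
      by simpa using hc.sub_const c, fun t ht => ⟨hint.mono_set (Ioi_subset_Ioi ht), ?_⟩⟩
    · rw [add_sub_cancel, QuasilinearODE.expAct_apply_expAct_neg]
    · exact (neg_sub _ _).symm.trans (congrArg Neg.neg (hr t ht).symm)
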